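/- A clustering game $\Gamma=(G,c,(S_i),\alpha,w,q)$ consists of a finite undirected graph $G=(V,E)$ whose nodes are the players and whose edge set is partitioned into coordination edges $E_c$ and anti-coordination edges $E_a$, a number $c$ of colors, a set $S_i\subseteq[c]$ of available colors for every player $i$, split parameters $\alpha_{ij}\ge 0$ with $\alpha_{ij}+\alpha_{ji}>0$ for every edge $\{i,j\}$, edge weights $w_e\ge 0$, and individual preferences $q_i:S_i\to\mathbb{R}_{\ge 0}$. In a profile $s\in\prod_i S_i$ player $i$ has utility $$u_i(s)=q_i(s_i)+\sum_{\{i,j\}\in E_c:\,s_i=s_j}\frac{\alpha_{ij}}{\alpha_{ij}+\alpha_{ji}}w_{ij}+\sum_{\{i,j\}\in E_a:\,s_i\ne s_j}\frac{\alpha_{ij}}{\alpha_{ij}+\alpha_{ji}}w_{ij},$$ the social welfare is $u(s)=\sum_i u_i(s)$, and $\mathrm{PoA}(\Gamma)=\max_s u(s^*)/u(s)$, where $s$ runs over the pure Nash equilibria of $\Gamma$ and $s^*$ maximizes $u$. The Price of Anarchy of a class $\mathcal G$ of games is $\mathrm{PoA}(\mathcal{G})=\sup_{\Gamma\in\mathcal{G}}\mathrm{PoA}(\Gamma)$,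 where games in which all profiles have welfare $0$ are disregarded. **Theorem (Dense random coordination games).** For a graph $G$ and $c\in\mathbb{N}$ let $\mathcal{G}_G(c)$ be the class of all symmetric ($S_i=[c]$ for all $i$) coordination games ($E_a=\emptyset$) on $G$ with $c$ colors, equal-split distribution rule ($\alpha_{ij}=\alpha_{ji}$), arbitrary weights $w\ge 0$ and no individual preferences ($q=0$). For every constant $0<d\le 1$ there is a constant $\beta=\beta(d)>0$ such that, for every sequence $(c_n)_{n\in\mathbb{N}}$ of numbers of colors with $c_n\to\infty$, and for the random graph $G_n\sim G(n,d)$, $$\lim_{n\to\infty}\mathbb{P}\bigl\{\mathrm{PoA}(\mathcal{G}_{G_n}(c_n))\ge\beta\cdot\min\{c_n,n\}\bigr\}=1 .$$ In particular $\mathrm{PoA}(\mathcal{G}_{G_n}(c_n))\ge\beta c_n$ with high probability whenever $c_n\le n$ for all large $n$. -/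

import Mathlib

open Filter Topology
open scoped ENNReal SimpleGraph

/-- A clustering game on the graph `G` (whose nodes are the players) with the colors
`Fin c`. -/
structure ClusteringGame {V : Type*} (G : SimpleGraph V) (c : ℕ) where
  /-- the coordination edges `E_c` -/
  coordEdges : Set (Sym2 V)
  /-- the anti-coordination edges `E_a` -/
  antiEdges : Set (Sym2 V)
  edges_eq : coordEdges ∪ antiEdges = G.edgeSet
  edges_disjoint : Disjoint coordEdges antiEdges
  /-- the set `S_i` of colors available to player `i` -/
  colors : V → Set (Fin c)
  /-- the distribution rule: `split i j` is the split parameter `α_{ij}`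
  of player `i` on the edge `{i, j}` (only its values on edges matter) -/
  split : V → V → ℝ
  split_nonneg : ∀ i j, G.Adj i j → 0 ≤ split i j
  split_pos : ∀ i j, G.Adj i j → 0 < split i j + split j i
  /-- the edge weights (only their values on edges matter) -/
  weight : Sym2 V → ℝ
  weight_nonneg : ∀ e ∈ G.edgeSet, 0 ≤ weight e
  /-- the individual preferences: `pref i a` is `q_i(a)` (only its values at `a ∈ S_i` matter) -/
  pref : V → Fin c → ℝ
  pref_nonneg : ∀ i, ∀ a ∈ colors i, 0 ≤ pref i a

namespace ClusteringGame

variable {V : Type*} {G : SimpleGraph V} {c : ℕ}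

/-- The strategy profiles of the game: every player chooses one of her available colors. -/
def IsProfile (Γ : ClusteringGame G c) (s : V → Fin c) : Prop :=
  ∀ i, s i ∈ Γ.colors i

/-- The part of the weight of the edge `{i, j}` that player `i` gets if the edge is satisfied. -/
noncomputable def share (Γ : ClusteringGame G c) (i j : V) : ℝ :=
  Γ.split i j / (Γ.split i j + Γ.split j i) * Γ.weight s(i, j)

open Classical in
/-- The utility `u_i(s)` of player `i`. -/
noncomputable def utility [Fintype V] (Γ : ClusteringGame G c) (s : V → Fin c) (i : V) : ℝ :=
  Γ.pref i (s i)
    + (∑ j : V, if s(i, j) ∈ Γ.coordEdges ∧ s i = s j then Γ.share i j else 0)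
    + (∑ j : V, if s(i, j) ∈ Γ.antiEdges ∧ s i ≠ s j then Γ.share i j else 0)

/-- The social welfare `u(s)`. -/
noncomputable def welfare [Fintype V] (Γ : ClusteringGame G c) (s : V → Fin c) : ℝ :=
  ∑ i : V, Γ.utility s i

/-- `s` is an `ε`-approximate `k`-strong equilibrium: for every joint deviation of a (nonempty)
set `K` of at most `k` players to a profile `s'`, some member of `K` does not improve her
utility by more than a factor `ε`. -/
def IsApproxStrongEq [Fintype V] (Γ : ClusteringGame G c) (ε : ℝ) (k : ℕ) (s : V → Fin c) :
    Prop :=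
  Γ.IsProfile s ∧ ∀ K : Finset V, K.Nonempty → K.card ≤ k → ∀ s' : V → Fin c,
    Γ.IsProfile s' → (∀ i, i ∉ K → s' i = s i) → ∃ j ∈ K, Γ.utility s' j ≤ ε * Γ.utility s j

/-- A pure Nash equilibrium. -/
def IsNash [Fintype V] (Γ : ClusteringGame G c) (s : V → Fin c) : Prop :=
  Γ.IsApproxStrongEq 1 1 s

/-- The social welfare of a social optimum. -/
noncomputable def optWelfare [Fintype V] (Γ : ClusteringGame G c) : ℝ≥0∞ :=
  ⨆ t : {t : V → Fin c // Γ.IsProfile t}, ENNReal.ofReal (Γ.welfare t)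

/-- The Price of Anarchy of a game: the worst ratio `u(s*) / u(s)` over the pure Nash equilibria
`s`, with `x / 0 = ∞` for `x > 0`; a degenerate game in which every profile has welfare
`0` gets the value `0` and so never contributes to the supremum over a class. -/
noncomputable def poa [Fintype V] (Γ : ClusteringGame G c) : ℝ≥0∞ :=
  ⨆ s : {s : V → Fin c // Γ.IsNash s}, Γ.optWelfare / ENNReal.ofReal (Γ.welfare s)

/-- Symmetric: every player has all colors available. -/
def IsSymmetric (Γ : ClusteringGame G c) : Prop :=
  ∀ i, Γ.colors i = Set.univ

/-- Coordination game: there are no anti-coordination edges. -/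
def IsCoordination (Γ : ClusteringGame G c) : Prop :=
  Γ.antiEdges = ∅

/-- Equal-split distribution rule. -/
def IsEqualSplit (Γ : ClusteringGame G c) : Prop :=
  ∀ i j, G.Adj i j → Γ.split i j = Γ.split j i

/-- No individual preferences. -/
def HasNoPreferences (Γ : ClusteringGame G c) : Prop :=
  ∀ i a, Γ.pref i a = 0

/-- The Price of Anarchy of a class of games on the graph `G` with `c` colors. -/
noncomputable def poaClass [Fintype V] (𝒢 : Set (ClusteringGame G c)) : ℝ≥0∞ :=
  ⨆ Γ ∈ 𝒢, Γ.poa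

end ClusteringGame

/-- The class of all symmetric coordination games on the graph `G` with `c` colors, with
equal-split distribution rule, arbitrary nonnegative edge weights and without individual
preferences. -/
def symmetricCoordinationGames {V : Type*} (G : SimpleGraph V) (c : ℕ) :
    Set (ClusteringGame G c) :=
  {Γ | Γ.IsSymmetric ∧ Γ.IsCoordination ∧ Γ.IsEqualSplit ∧ Γ.HasNoPreferences}

/-! In the corona of a graph `K` (one pendant neighbor attached to every vertex), color each vertex
like its pendant neighbor, with different colors for different vertices of `K`. With unit weights
this is a Nash equilibrium, since every player already has a neighbor of her color and no deviation
can give her more than one. Its welfare is the number of vertices of `K`, while a single color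
earns at least the number of edges of `K`, so the ratio is at least half the average degree of `K`.
The lower bound passes from a subgraph to the whole graph by giving weight `0` to all other edges.

In `G(n, p)` fix `2 * M` disjoint pairs of vertices with `2 * M ≤ c` and `4 * M ≤ n`, split into
two halves of `M`. A pair from each half, joined by an edge between their first vertices, asks for
three edges of `G`, which has probability `p ^ 3`, and two such events that share no pair are
independent. Hence each of the `M ^ 2` events depends on at most `2 * M` of them, and Chebyshev's
inequality shows that `p ^ 3 * M ^ 2 / 2` of them occur with probability at least
`1 - 8 / (p ^ 3 * M)`. The pairs then form a corona whose ratio is at least `p ^ 3 * M / 4`. -/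

namespace ClusteringGame

section PureNash

variable {V : Type*} [Fintype V] {G : SimpleGraph V} {c : ℕ} {Γ : ClusteringGame G c}
  {s t : V → Fin c}

lemma isNash_iff_utility_update_le [DecidableEq V] :
    Γ.IsNash s ↔ Γ.IsProfile s ∧
      ∀ i, ∀ a ∈ Γ.colors i, Γ.utility (Function.update s i a) i ≤ Γ.utility s i := by
  refine and_congr_right fun hs => ⟨fun h i a ha => ?_, fun h K hK hcard s' hs' hfix => ?_⟩
  · have hprofile : Γ.IsProfile (Function.update s i a) := fun j => by
      obtain rfl | hij := eq_or_ne j i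
      · rwa [Function.update_self]
      · rw [Function.update_of_ne hij]; exact hs j
    simpa using h {i} (Finset.singleton_nonempty i) (Finset.card_singleton i).le _ hprofile
      fun j hj => Function.update_of_ne (by simpa using hj) _ _
  · obtain ⟨i, rfl⟩ := Finset.card_eq_one.1 (hcard.antisymm hK.card_pos)
    have hs'_eq : s' = Function.update s i (s' i) :=
      Function.eq_update_iff.2 ⟨rfl, fun j hj => hfix j (by simpa using hj)⟩
    refine ⟨i, Finset.mem_singleton_self i, ?_⟩
    rw [one_mul, hs'_eq]
    exact h i _ (hs' i)

lemma ofReal_welfare_div_le_poaClass {𝒢 : Set (ClusteringGame G c)} (hΓ : Γ ∈ 𝒢)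
    (hs : Γ.IsNash s) (ht : Γ.IsProfile t) :
    ENNReal.ofReal (Γ.welfare t) / ENNReal.ofReal (Γ.welfare s) ≤ poaClass 𝒢 := by
  have hopt : ENNReal.ofReal (Γ.welfare t) ≤ Γ.optWelfare := le_iSup_of_le ⟨t, ht⟩ le_rfl
  have hpoa : Γ.optWelfare / ENNReal.ofReal (Γ.welfare s) ≤ Γ.poa := le_iSup_of_le ⟨s, hs⟩ le_rfl
  exact (ENNReal.div_le_div_right hopt _).trans (hpoa.trans (le_iSup₂_of_le Γ hΓ le_rfl))

end PureNash

/-- The symmetric equal-split coordination game without preferences on `G` with edge weights `w`;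
the split parameters are normalised to `1`. -/
noncomputable def ofWeight {V : Type*} (G : SimpleGraph V) (c : ℕ) (w : Sym2 V → ℝ)
    (hw : ∀ e ∈ G.edgeSet, 0 ≤ w e) : ClusteringGame G c where
  coordEdges := G.edgeSet
  antiEdges := ∅
  edges_eq := Set.union_empty _
  edges_disjoint := Set.disjoint_empty _
  colors _ := Set.univ
  split _ _ := 1
  split_nonneg _ _ _ := zero_le_one
  split_pos _ _ _ := by norm_num
  weight := w
  weight_nonneg := hw
  pref _ _ := 0
  pref_nonneg _ _ _ := le_rfl

section SymmetricCoordination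

variable {V W : Type*} {G : SimpleGraph V} {H : SimpleGraph W} {c : ℕ}

lemma ofWeight_mem_symmetricCoordinationGames {w : Sym2 V → ℝ} (hw : ∀ e ∈ G.edgeSet, 0 ≤ w e) :
    ofWeight G c w hw ∈ symmetricCoordinationGames G c :=
  ⟨fun _ => rfl, rfl, fun _ _ _ => rfl, fun _ _ => rfl⟩

lemma isProfile_of_mem_symmetricCoordinationGames {Γ : ClusteringGame G c}
    (hΓ : Γ ∈ symmetricCoordinationGames G c) (s : V → Fin c) : Γ.IsProfile s :=
  fun i => hΓ.1 i ▸ Set.mem_univ _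

open Classical in
lemma utility_of_mem_symmetricCoordinationGames [Fintype V] {Γ : ClusteringGame G c}
    (hΓ : Γ ∈ symmetricCoordinationGames G c) (s : V → Fin c) (i : V) :
    Γ.utility s i = ∑ j, if G.Adj i j ∧ s i = s j then Γ.weight s(i, j) / 2 else 0 := by
  obtain ⟨-, hanti, hsplit, hpref⟩ := hΓ
  rw [IsCoordination] at hanti
  have hcoord : Γ.coordEdges = G.edgeSet := by rw [← Γ.edges_eq, hanti, Set.union_empty]
  have hshare : ∀ j, G.Adj i j → Γ.share i j = Γ.weight s(i, j) / 2 := fun j hij => by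
    have hpos : 0 < Γ.split j i := by linarith [Γ.split_pos i j hij, hsplit i j hij]
    rw [share, hsplit i j hij]
    field_simp
    ring
  simp only [utility, hpref i (s i), hanti, hcoord, SimpleGraph.mem_edgeSet,
    Set.mem_empty_iff_false, false_and, if_false, Finset.sum_const_zero, zero_add, add_zero]
  refine Finset.sum_congr rfl fun j _ => ?_
  split_ifs with h
  exacts [hshare j h.1, rfl]

/-- The transport of a symmetric coordination game on `H` along a copy of `H` in `G`: edges of `G`
outside the copy get weight `0`. Restricting to the edges of `H` discards the possibly negative
values of the weight function on non-edges. -/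
noncomputable def alongCopy (Γ : ClusteringGame H c) (f : SimpleGraph.Copy H G) :
    ClusteringGame G c :=
  ofWeight G c (Function.extend (Sym2.map f) (H.edgeSet.indicator Γ.weight) 0) fun e _ => by
    obtain ⟨e, rfl⟩ | he := em (∃ e', Sym2.map f e' = e)
    · rw [(Sym2.map.injective (f := f) f.injective).extend_apply]
      exact Set.indicator_nonneg Γ.weight_nonneg e
    · rw [Function.extend_apply' _ _ _ he, Pi.zero_apply]

variable {Γ : ClusteringGame H c}

lemma alongCopy_mem_symmetricCoordinationGames (f : SimpleGraph.Copy H G) :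
    Γ.alongCopy f ∈ symmetricCoordinationGames G c :=
  ofWeight_mem_symmetricCoordinationGames _

lemma weight_alongCopy_map (f : SimpleGraph.Copy H G) (e : Sym2 W) :
    (Γ.alongCopy f).weight (e.map f) = H.edgeSet.indicator Γ.weight e :=
  (Sym2.map.injective (f := f) f.injective).extend_apply _ _ e

lemma weight_alongCopy_eq_zero (f : SimpleGraph.Copy H G) {v v' : V}
    (h : v ∉ Set.range f ∨ v' ∉ Set.range f) : (Γ.alongCopy f).weight s(v, v') = 0 := by
  refine Function.extend_apply' _ _ _ ?_
  rintro ⟨e, he⟩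
  induction e with | _ i j => ?_
  rw [Sym2.map_mk, Sym2.eq_iff] at he
  grind

variable [Fintype V]

lemma utility_alongCopy_eq_zero (f : SimpleGraph.Copy H G) (s : V → Fin c) {v : V}
    (hv : v ∉ Set.range f) : (Γ.alongCopy f).utility s v = 0 := by
  rw [utility_of_mem_symmetricCoordinationGames (alongCopy_mem_symmetricCoordinationGames f)]
  simp [weight_alongCopy_eq_zero f (Or.inl hv)]

variable [Fintype W]

lemma utility_alongCopy_apply (hΓ : Γ ∈ symmetricCoordinationGames H c)
    (f : SimpleGraph.Copy H G) (s : V → Fin c) (i : W) :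
    (Γ.alongCopy f).utility s (f i) = Γ.utility (s ∘ f) i := by
  classical
  rw [utility_of_mem_symmetricCoordinationGames (alongCopy_mem_symmetricCoordinationGames f),
    utility_of_mem_symmetricCoordinationGames hΓ]
  refine (Fintype.sum_of_injective f f.injective _ _ (fun v hv => ?_) fun j => ?_).symm
  · rw [weight_alongCopy_eq_zero f (Or.inr hv), zero_div, ite_self]
  · rw [← Sym2.map_mk, weight_alongCopy_map]
    by_cases hij : H.Adj i j
    · have : G.Adj (f i) (f j) := f.toHom.map_adj hij
      simp [hij, this]
    · simp [hij]

lemma welfare_alongCopy (hΓ : Γ ∈ symmetricCoordinationGames H c) (f : SimpleGraph.Copy H G)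
    (s : V → Fin c) : (Γ.alongCopy f).welfare s = Γ.welfare (s ∘ f) :=
  (Fintype.sum_of_injective f f.injective _ _ (fun _ => utility_alongCopy_eq_zero f s)
    fun i => (utility_alongCopy_apply hΓ f s i).symm).symm

lemma isNash_alongCopy (hΓ : Γ ∈ symmetricCoordinationGames H c) (f : SimpleGraph.Copy H G)
    {s : V → Fin c} (hs : Γ.IsNash (s ∘ f)) : (Γ.alongCopy f).IsNash s := by
  classical
  have hs' := (isNash_iff_utility_update_le.1 hs).2
  refine isNash_iff_utility_update_le.2 ⟨fun _ => Set.mem_univ _, fun v a _ => ?_⟩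
  obtain ⟨i, rfl⟩ | hv := em (v ∈ Set.range f)
  · rw [utility_alongCopy_apply hΓ, utility_alongCopy_apply hΓ,
      Function.update_comp_eq_of_injective _ (f := f) f.injective]
    exact hs' i a (hΓ.1 i ▸ Set.mem_univ a)
  · rw [utility_alongCopy_eq_zero f _ hv, utility_alongCopy_eq_zero f _ hv]

lemma poaClass_symmetricCoordinationGames_mono (h : H.IsContained G) :
    poaClass (symmetricCoordinationGames H c) ≤ poaClass (symmetricCoordinationGames G c) := by
  obtain ⟨f⟩ := h
  refine iSup₂_le fun Γ hΓ => iSup_le fun ⟨s, hs⟩ => ?_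
  simp only [optWelfare, ENNReal.iSup_div]
  refine iSup_le fun ⟨t, _⟩ => ?_
  obtain hW | ⟨⟨i⟩⟩ := isEmpty_or_nonempty W
  · simp [welfare]
  have hextend : ∀ t : W → Fin c, Function.extend f t (fun _ => s i) ∘ f = t := fun t =>
    Function.extend_comp f.injective _ _
  have hs' := isNash_alongCopy hΓ f (s := Function.extend f s fun _ => s i) (by rwa [hextend])
  simpa only [welfare_alongCopy hΓ, hextend] using
    ofReal_welfare_div_le_poaClass (alongCopy_mem_symmetricCoordinationGames f) hs'
      (isProfile_of_mem_symmetricCoordinationGames (alongCopy_mem_symmetricCoordinationGames f)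
        (Function.extend f t fun _ => s i))

end SymmetricCoordination

/-- The symmetric equal-split coordination game on `G` in which all edges have weight `1`. -/
noncomputable def unitWeight {V : Type*} (G : SimpleGraph V) (c : ℕ) : ClusteringGame G c :=
  ofWeight G c 1 fun _ _ => zero_le_one

section UnitWeight

variable {V : Type*} {G : SimpleGraph V} {c : ℕ}

lemma unitWeight_mem_symmetricCoordinationGames :
    unitWeight G c ∈ symmetricCoordinationGames G c :=
  ofWeight_mem_symmetricCoordinationGames _

variable [Fintype V]

open Classical in
lemma utility_unitWeight (s : V → Fin c) (i : V) :
    (unitWeight G c).utility s i =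
      (Finset.univ.filter fun j => G.Adj i j ∧ s i = s j).card / 2 := by
  rw [utility_of_mem_symmetricCoordinationGames unitWeight_mem_symmetricCoordinationGames]
  simp [unitWeight, ofWeight, div_eq_mul_inv, ← Finset.sum_filter]

lemma welfare_unitWeight_const [DecidableRel G.Adj] (a : Fin c) :
    (unitWeight G c).welfare (fun _ => a) = G.edgeFinset.card := by
  have hdeg : ∀ i, (unitWeight G c).utility (fun _ => a) i = G.degree i / 2 := fun i => by
    simp [utility_unitWeight, ← SimpleGraph.card_neighborFinset_eq_degree,
      SimpleGraph.neighborFinset_eq_filter]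
  have hsum : (∑ i, (G.degree i : ℝ)) = 2 * G.edgeFinset.card := by
    exact_mod_cast G.sum_degrees_eq_twice_card_edges
  rw [welfare, Finset.sum_congr rfl fun i _ => hdeg i, ← Finset.sum_div, hsum]
  ring

end UnitWeight

end ClusteringGame

/-- The corona of `K` with a single vertex: every vertex `i` of `K`, placed at `(i, false)`, gets
a pendant neighbor `(i, true)`. -/
def corona {ι : Type*} (K : SimpleGraph ι) : SimpleGraph (ι × Bool) where
  Adj p q := p.1 = q.1 ∧ p.2 ≠ q.2 ∨ p.2 = false ∧ q.2 = false ∧ K.Adj p.1 q.1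
  symm := ⟨fun _ _ => Or.imp (.imp Eq.symm Ne.symm) fun ⟨hp, hq, h⟩ => ⟨hq, hp, h.symm⟩⟩
  loopless := ⟨fun _ h => h.elim (fun h => h.2 rfl) fun h => K.irrefl h.2.2⟩

section Corona

open ClusteringGame

variable {ι : Type*} {K : SimpleGraph ι} {c : ℕ}

lemma corona_adj_pendant (p : ι × Bool) : (corona K).Adj p (p.1, !p.2) :=
  Or.inl ⟨rfl, (Bool.not_ne_self p.2).symm⟩

lemma eq_of_corona_adj_of_fst_eq {p q q' : ι × Bool} (h : (corona K).Adj p q)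
    (h' : (corona K).Adj p q') (hqq' : q.1 = q'.1) : q = q' := by
  obtain ⟨i, x⟩ := p
  obtain ⟨j, y⟩ := q
  obtain ⟨j', y'⟩ := q'
  obtain rfl : j = j' := hqq'
  have := K.irrefl (v := j)
  cases x <;> cases y <;> cases y' <;> simp_all [corona]

lemma card_edgeFinset_le_card_edgeFinset_corona [Fintype K.edgeSet]
    [Fintype (corona K).edgeSet] :
    K.edgeFinset.card ≤ (corona K).edgeFinset.card := by
  let f : K ↪g corona K := ⟨⟨(·, false), Prod.mk_left_injective false⟩, by simp [corona]⟩
  simpa only [SimpleGraph.edgeFinset_card] using Fintype.card_le_of_embedding f.mapEdgeSet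

variable [Fintype ι]

open Classical in
lemma utility_unitWeight_corona (col : ι ↪ Fin c) (p : ι × Bool) :
    (unitWeight (corona K) c).utility (col ∘ Prod.fst) p = 1 / 2 := by
  have hpartner : (Finset.univ.filter fun q =>
      (corona K).Adj p q ∧ (col ∘ Prod.fst) p = (col ∘ Prod.fst) q) = {(p.1, !p.2)} := by
    ext q
    simp only [Finset.mem_filter, Finset.mem_univ, true_and, Finset.mem_singleton,
      Function.comp_apply, col.apply_eq_iff_eq]
    exact ⟨fun h => eq_of_corona_adj_of_fst_eq h.1 (corona_adj_pendant p) h.2.symm,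
      fun h => h ▸ ⟨corona_adj_pendant p, rfl⟩⟩
  rw [utility_unitWeight, hpartner, Finset.card_singleton, Nat.cast_one]

lemma isNash_unitWeight_corona (col : ι ↪ Fin c) :
    (unitWeight (corona K) c).IsNash (col ∘ Prod.fst) := by
  classical
  refine isNash_iff_utility_update_le.2 ⟨fun _ => Set.mem_univ _, fun p a _ => ?_⟩
  rw [utility_unitWeight_corona, utility_unitWeight]
  gcongr
  refine Nat.cast_le_one.2 (Finset.card_le_one.2 fun q hq q' hq' => ?_)
  simp only [Finset.mem_filter, Finset.mem_univ, true_and, Function.update_self] at hq hq'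
  have hcol := hq.2.symm.trans hq'.2
  rw [Function.update_of_ne hq.1.ne', Function.update_of_ne hq'.1.ne'] at hcol
  exact eq_of_corona_adj_of_fst_eq hq.1 hq'.1 (col.injective hcol)

lemma card_edgeFinset_div_card_le_poaClass_corona [Fintype K.edgeSet]
    (hc : Fintype.card ι ≤ c) :
    (K.edgeFinset.card / Fintype.card ι : ℝ≥0∞)
      ≤ poaClass (symmetricCoordinationGames (corona K) c) := by
  classical
  obtain hι | ⟨⟨i⟩⟩ := isEmpty_or_nonempty ι
  · simp [Finset.eq_empty_of_isEmpty K.edgeFinset]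
  obtain ⟨col⟩ : Nonempty (ι ↪ Fin c) := Function.Embedding.nonempty_of_card_le (by simpa)
  have hnash : (unitWeight (corona K) c).welfare (col ∘ Prod.fst) = Fintype.card ι := by
    simp [welfare, utility_unitWeight_corona]
  have hpoa := ofReal_welfare_div_le_poaClass unitWeight_mem_symmetricCoordinationGames
    (isNash_unitWeight_corona (K := K) col) (t := fun _ => col i) fun _ => Set.mem_univ _
  rw [hnash, welfare_unitWeight_const, ENNReal.ofReal_natCast, ENNReal.ofReal_natCast] at hpoa
  refine le_trans ?_ hpoa
  gcongr
  exact card_edgeFinset_le_card_edgeFinset_corona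

end Corona

/-- For disjoint pairs of vertices `f (i, false)`, `f (i, true)` of `G`, the graph on the indices
in which `i` and `j` are adjacent iff both pairs are edges of `G` and their first vertices are
adjacent, so that `f (i, true)` and `f (j, true)` can serve as pendant neighbors in a corona. -/
def pendantGraph {V ι : Type*} (G : SimpleGraph V) (f : ι × Bool ↪ V) : SimpleGraph ι where
  Adj i j := G.Adj (f (i, false)) (f (j, false)) ∧
    G.Adj (f (i, false)) (f (i, true)) ∧ G.Adj (f (j, false)) (f (j, true))
  symm := ⟨fun _ _ ⟨hij, hi, hj⟩ => ⟨hij.symm, hj, hi⟩⟩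
  loopless := ⟨fun _ h => G.irrefl h.1⟩

section PendantGraph

open ClusteringGame

variable {V ι : Type*} {G : SimpleGraph V}

lemma corona_induce_support_pendantGraph_isContained (f : ι × Bool ↪ V) :
    (corona ((pendantGraph G f).induce (pendantGraph G f).support)).IsContained G := by
  refine ⟨⟨⟨fun p => f (p.1, p.2), ?_⟩, ?_⟩⟩
  · rintro ⟨⟨i, _, _, hi, _⟩, x⟩ ⟨⟨j, _⟩, y⟩ (⟨hij, hxy⟩ | ⟨hx, hy, hij⟩)
    · obtain rfl : i = j := congrArg Subtype.val hij
      cases x <;> cases y <;> simp_all [hi.symm]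
    · obtain rfl : x = false := hx
      obtain rfl : y = false := hy
      exact hij.1
  · exact f.injective.comp (Subtype.val_injective.prodMap Function.injective_id)

lemma card_edgeFinset_pendantGraph_div_card_le_poaClass [Fintype V] [Fintype ι]
    (f : ι × Bool ↪ V) [Fintype (pendantGraph G f).edgeSet] {c : ℕ} (hc : Fintype.card ι ≤ c) :
    ((pendantGraph G f).edgeFinset.card / Fintype.card ι : ℝ≥0∞)
      ≤ poaClass (symmetricCoordinationGames G c) := by
  classical
  set K := (pendantGraph G f).induce (pendantGraph G f).support
  have hcard : Fintype.card (pendantGraph G f).support ≤ Fintype.card ι :=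
    Fintype.card_subtype_le _
  calc ((pendantGraph G f).edgeFinset.card / Fintype.card ι : ℝ≥0∞)
      = K.edgeFinset.card / Fintype.card ι := by
        rw [SimpleGraph.card_edgeFinset_induce_support]
        congr!
    _ ≤ K.edgeFinset.card / Fintype.card (pendantGraph G f).support := by gcongr
    _ ≤ poaClass (symmetricCoordinationGames (corona K) c) :=
        card_edgeFinset_div_card_le_poaClass_corona (hcard.trans hc)
    _ ≤ poaClass (symmetricCoordinationGames G c) :=
        poaClass_symmetricCoordinationGames_mono (corona_induce_support_pendantGraph_isContained f)

end PendantGraph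

section SecondMoment

open MeasureTheory ProbabilityTheory

variable {Ω : Type*} [MeasurableSpace Ω] {μ : Measure Ω}

lemma memLp_indicator_one [IsFiniteMeasure μ] {A : Set Ω} (hA : MeasurableSet A) :
    MemLp (A.indicator (1 : Ω → ℝ)) 2 μ :=
  (memLp_const (1 : ℝ)).indicator hA

variable [IsProbabilityMeasure μ]

lemma covariance_indicator_one {A B : Set Ω} (hA : MeasurableSet A) (hB : MeasurableSet B) :
    cov[A.indicator (1 : Ω → ℝ), B.indicator 1; μ] = μ.real (A ∩ B) - μ.real A * μ.real B := by
  rw [covariance_eq_sub (memLp_indicator_one hA) (memLp_indicator_one hB),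
    ← Set.inter_indicator_one, integral_indicator_one (hA.inter hB), integral_indicator_one hA,
    integral_indicator_one hB]

variable {ι : Type*} [Fintype ι] {E : ι → Set Ω} {D : ℕ}

open Classical in
lemma variance_sum_indicator_one_le (hE : ∀ i, MeasurableSet (E i))
    (hD : ∀ i, (Finset.univ.filter fun j => ¬ IndepSet (E i) (E j) μ).card ≤ D) :
    Var[∑ i, (E i).indicator (1 : Ω → ℝ); μ] ≤ D * ∑ i, μ.real (E i) := by
  have hcov : ∀ i j, cov[(E i).indicator (1 : Ω → ℝ), (E j).indicator 1; μ]
      ≤ if IndepSet (E i) (E j) μ then 0 else μ.real (E i) := fun i j => by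
    rw [covariance_indicator_one (hE i) (hE j)]
    split_ifs with hij
    · simp [measureReal_def, hij.measure_inter_eq_mul]
    · have hinter : μ.real (E i ∩ E j) ≤ μ.real (E i) := measureReal_mono Set.inter_subset_left
      have hprod : 0 ≤ μ.real (E i) * μ.real (E j) := by positivity
      linarith
  calc Var[∑ i, (E i).indicator (1 : Ω → ℝ); μ]
      = ∑ i, ∑ j, cov[(E i).indicator (1 : Ω → ℝ), (E j).indicator 1; μ] :=
        variance_sum fun i => memLp_indicator_one (hE i)
    _ ≤ ∑ i, ∑ j, if IndepSet (E i) (E j) μ then 0 else μ.real (E i) := by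
        gcongr with i _ j
        exact hcov i j
    _ = ∑ i, (Finset.univ.filter fun j => ¬ IndepSet (E i) (E j) μ).card * μ.real (E i) := by
        refine Finset.sum_congr rfl fun i _ => ?_
        simp only [Finset.sum_ite, Finset.sum_const_zero, zero_add, Finset.sum_const, nsmul_eq_mul]
    _ ≤ ∑ i, D * μ.real (E i) := by
        gcongr with i
        exact hD i
    _ = D * ∑ i, μ.real (E i) := (Finset.mul_sum _ _ _).symm

open Classical in
lemma one_sub_le_measure_half_le_card_filter (hE : ∀ i, MeasurableSet (E i))
    (hD : ∀ i, (Finset.univ.filter fun j => ¬ IndepSet (E i) (E j) μ).card ≤ D)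
    {m : ℝ} (hm : 0 < m) (hsum : ∑ i, μ.real (E i) = m) :
    1 - ENNReal.ofReal (4 * D / m)
      ≤ μ {ω | m / 2 ≤ (Finset.univ.filter fun i => ω ∈ E i).card} := by
  set X : Ω → ℝ := ∑ i, (E i).indicator 1 with hX
  have hXcard : ∀ ω, X ω = (Finset.univ.filter fun i => ω ∈ E i).card := fun ω => by
    simp [hX, Set.indicator_apply]
  have hLp : MemLp X 2 μ := memLp_finsetSum' _ fun i _ => memLp_indicator_one (hE i)
  have hmean : μ[X] = m := by
    simp only [hX, Finset.sum_apply, ← hsum]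
    rw [integral_finsetSum _ fun i _ => (memLp_indicator_one (hE i)).integrable one_le_two]
    exact Finset.sum_congr rfl fun i _ => integral_indicator_one (hE i)
  have hchebyshev : μ {ω | m / 2 ≤ |X ω - m|} ≤ ENNReal.ofReal (4 * D / m) := calc
    μ {ω | m / 2 ≤ |X ω - m|} ≤ ENNReal.ofReal (Var[X; μ] / (m / 2) ^ 2) :=
        hmean ▸ meas_ge_le_variance_div_sq hLp (half_pos (hmean.symm ▸ hm))
    _ ≤ ENNReal.ofReal (D * m / (m / 2) ^ 2) := by
        gcongr
        exact (variance_sum_indicator_one_le hE hD).trans_eq (by rw [hsum])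
    _ = ENNReal.ofReal (4 * D / m) := by
        congr 1
        field_simp
        norm_num
  have hcompl : {ω | m / 2 ≤ |X ω - m|}ᶜ
      ⊆ {ω | m / 2 ≤ ((Finset.univ.filter fun i => ω ∈ E i).card : ℝ)} := fun ω hω => by
    have hlt : |X ω - m| < m / 2 := by simpa using hω
    rw [Set.mem_ofPred_eq, ← hXcard]
    linarith [(abs_lt.1 hlt).1]
  rw [tsub_le_iff_left]
  calc 1 = μ Set.univ := measure_univ.symm
    _ ≤ μ {ω | m / 2 ≤ |X ω - m|} + μ {ω | m / 2 ≤ |X ω - m|}ᶜ := measure_univ_le_add_compl _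
    _ ≤ _ := add_le_add hchebyshev (measure_mono hcompl)

end SecondMoment

section BinomialRandomGraph

open MeasureTheory ProbabilityTheory SimpleGraph unitInterval

lemma setBernoulli_superset {α : Type*} {u : Set α} {T : Finset α} (hT : ↑T ⊆ u) (p : I) :
    setBer(u, p) {s | ↑T ⊆ s} = (toNNReal p : ℝ≥0∞) ^ T.card := by
  have hpi : (fun q : α → Prop => {a | q a}) ⁻¹' {s | ↑T ⊆ s} = Set.pi T fun _ => {True} := by
    ext q
    simp [Set.subset_def]
  rw [setBernoulli_apply', hpi, Measure.infinitePi_pi _ fun _ _ => .of_discrete]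
  refine Finset.prod_eq_pow_card fun e he => ?_
  simp [hT he]

variable {V : Type*} {T T' : Finset (Sym2 V)}

lemma measurableSet_subset_edgeSet (T : Finset (Sym2 V)) :
    MeasurableSet {G : SimpleGraph V | ↑T ⊆ G.edgeSet} := by
  simp only [Set.subset_def, Finset.mem_coe, Set.ofPred_forall]
  exact T.measurableSet_biInter fun e _ =>
    measurableSet_setOfPred.2 (measurable_set_iff.1 measurable_edgeSet e)

variable [Countable V]

lemma binomialRandom_subset_edgeSet (hT : ∀ e ∈ T, ¬ e.IsDiag) (p : I) :
    G(V, p) {G | ↑T ⊆ G.edgeSet} = (toNNReal p : ℝ≥0∞) ^ T.card := by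
  have hT' : (T : Set (Sym2 V)) ⊆ Sym2.diagSetᶜ := hT
  have hpre : fromEdgeSet ⁻¹' {G : SimpleGraph V | ↑T ⊆ G.edgeSet} = {s | ↑T ⊆ s} := by
    ext s
    simp [Set.subset_sdiff, Set.subset_compl_iff_disjoint_right.1 hT']
  rw [binomialRandom_eq_map, Measure.map_apply measurable_fromEdgeSet
    (measurableSet_subset_edgeSet T), hpre, setBernoulli_superset hT']

lemma indepSet_subset_edgeSet (hT : ∀ e ∈ T, ¬ e.IsDiag) (hT' : ∀ e ∈ T', ¬ e.IsDiag)
    (hTT' : Disjoint T T') (p : I) :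
    IndepSet {G | ↑T ⊆ G.edgeSet} {G | ↑T' ⊆ G.edgeSet} G(V, p) := by
  have hinter : {G : SimpleGraph V | ↑T ⊆ G.edgeSet} ∩ {G | ↑T' ⊆ G.edgeSet}
      = {G | ↑(T.disjUnion T' hTT') ⊆ G.edgeSet} := by
    ext G
    simp
  refine (indepSet_iff_measure_inter_eq_mul (measurableSet_subset_edgeSet T)
    (measurableSet_subset_edgeSet T') _).2 ?_
  rw [hinter, binomialRandom_subset_edgeSet hT, binomialRandom_subset_edgeSet hT',
    binomialRandom_subset_edgeSet, Finset.card_disjUnion, pow_add]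
  simpa only [Finset.mem_disjUnion, or_imp, forall_and] using ⟨hT, hT'⟩

end BinomialRandomGraph

/-- The edges of the path `f (i, true)`, `f (i, false)`, `f (j, false)`, `f (j, true)`, which is
contained in `G` iff `i` and `j` are adjacent in `pendantGraph G f`. -/
def pendantPathEdges {V ι : Type*} [DecidableEq V] (f : ι × Bool ↪ V) (i j : ι) :
    Finset (Sym2 V) :=
  {s(f (i, false), f (j, false)), s(f (i, false), f (i, true)), s(f (j, false), f (j, true))}

section RandomPendantGraph

open ClusteringGame MeasureTheory ProbabilityTheory SimpleGraph unitInterval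

variable {V ι : Type*} {f : ι × Bool ↪ V} {i j i' j' : ι}

section PendantPathEdges

variable [DecidableEq V]

lemma pendantPathEdges_subset_edgeSet_iff {G : SimpleGraph V} :
    ↑(pendantPathEdges f i j) ⊆ G.edgeSet ↔ (pendantGraph G f).Adj i j := by
  simp [pendantPathEdges, pendantGraph, Set.insert_subset_iff]

lemma card_pendantPathEdges (hij : i ≠ j) : (pendantPathEdges f i j).card = 3 :=
  Finset.card_eq_three.2 ⟨_, _, _, by simp, by simp, by simp [hij], rfl⟩

lemma not_isDiag_of_mem_pendantPathEdges (hij : i ≠ j) {e : Sym2 V}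
    (he : e ∈ pendantPathEdges f i j) : ¬ e.IsDiag := by
  simp only [pendantPathEdges, Finset.mem_insert, Finset.mem_singleton] at he
  obtain rfl | rfl | rfl := he <;> simp [hij]

lemma disjoint_pendantPathEdges (h : Disjoint ({i, j} : Set ι) {i', j'}) :
    Disjoint (pendantPathEdges f i j) (pendantPathEdges f i' j') := by
  simp only [Set.disjoint_insert_left, Set.disjoint_singleton_left, Set.mem_insert_iff,
    Set.mem_singleton_iff, not_or] at h
  simp [pendantPathEdges, h, eq_comm]

end PendantPathEdges

lemma measurableSet_pendantGraph_adj :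
    MeasurableSet {G : SimpleGraph V | (pendantGraph G f).Adj i j} := by
  classical
  simpa only [pendantPathEdges_subset_edgeSet_iff] using
    measurableSet_subset_edgeSet (pendantPathEdges f i j)

variable [Countable V]

lemma binomialRandom_real_pendantGraph_adj (hij : i ≠ j) (p : I) :
    G(V, p).real {G | (pendantGraph G f).Adj i j} = (p : ℝ) ^ 3 := by
  classical
  have hprob := binomialRandom_subset_edgeSet
    (fun _ => not_isDiag_of_mem_pendantPathEdges (f := f) hij) p
  simp only [pendantPathEdges_subset_edgeSet_iff, card_pendantPathEdges hij] at hprob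
  simp [measureReal_def, hprob]

lemma indepSet_pendantGraph_adj (hij : i ≠ j) (hij' : i' ≠ j')
    (h : Disjoint ({i, j} : Set ι) {i', j'}) (p : I) :
    IndepSet {G | (pendantGraph G f).Adj i j} {G | (pendantGraph G f).Adj i' j'} G(V, p) := by
  classical
  simpa only [pendantPathEdges_subset_edgeSet_iff] using indepSet_subset_edgeSet
    (fun _ => not_isDiag_of_mem_pendantPathEdges (f := f) hij)
    (fun _ => not_isDiag_of_mem_pendantPathEdges hij') (disjoint_pendantPathEdges h) p

open Classical in
lemma card_filter_adj_inl_inr_le {α β : Type*} [Fintype α] [Fintype β]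
    (K : SimpleGraph (α ⊕ β)) :
    (Finset.univ.filter fun q : α × β => K.Adj (.inl q.1) (.inr q.2)).card
      ≤ K.edgeFinset.card := by
  refine Finset.card_le_card_of_injOn (fun q => s(.inl q.1, .inr q.2)) (fun q hq => ?_)
    fun q _ q' _ hqq' => ?_
  · simpa using hq
  · simpa [Prod.ext_iff] using hqq'

lemma card_filter_fst_eq_or_snd_eq_le {α β : Type*} [Fintype α] [Fintype β] [DecidableEq α]
    [DecidableEq β] (q : α × β) :
    (Finset.univ.filter fun q' : α × β => q.1 = q'.1 ∨ q.2 = q'.2).card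
      ≤ Fintype.card β + Fintype.card α := by
  have hsubset : (Finset.univ.filter fun q' : α × β => q.1 = q'.1 ∨ q.2 = q'.2)
      ⊆ {q.1} ×ˢ Finset.univ ∪ Finset.univ ×ˢ {q.2} := fun q' => by
    simp only [Finset.mem_filter, Finset.mem_union, Finset.mem_product, Finset.mem_singleton,
      Finset.mem_univ, true_and, and_true]
    exact Or.imp Eq.symm Eq.symm
  simpa using (Finset.card_le_card hsubset).trans (Finset.card_union_le _ _)

open Classical in
lemma one_sub_le_binomialRandom_card_edgeFinset_pendantGraph {M : ℕ} (hM : 0 < M)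
    (f : (Fin M ⊕ Fin M) × Bool ↪ V) {p : I} (hp : 0 < (p : ℝ)) :
    1 - ENNReal.ofReal (8 / ((p : ℝ) ^ 3 * M))
      ≤ G(V, p) {G | (p : ℝ) ^ 3 * M ^ 2 / 2 ≤ (pendantGraph G f).edgeFinset.card} := by
  set E : Fin M × Fin M → Set (SimpleGraph V) := fun q =>
    {G | (pendantGraph G f).Adj (.inl q.1) (.inr q.2)} with hE
  have hindep : ∀ q q', q.1 ≠ q'.1 → q.2 ≠ q'.2 → IndepSet (E q) (E q') G(V, p) :=
    fun q q' h₁ h₂ => indepSet_pendantGraph_adj Sum.inl_ne_inr Sum.inl_ne_inr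
      (by simp [h₁.symm, h₂.symm]) p
  have hdep : ∀ q, (Finset.univ.filter fun q' => ¬ IndepSet (E q) (E q') G(V, p)).card
      ≤ M + M := fun q => by
    refine (Finset.card_le_card (Finset.monotone_filter_right _ fun q' _ h => ?_)).trans
      ((card_filter_fst_eq_or_snd_eq_le q).trans_eq (by simp))
    by_contra! hne
    exact h (hindep q q' hne.1 hne.2)
  have hsum : ∑ q, G(V, p).real (E q) = (p : ℝ) ^ 3 * M ^ 2 := by
    simp only [hE, binomialRandom_real_pendantGraph_adj Sum.inl_ne_inr]
    simp
    ring
  have : (0 : ℝ) < M := Nat.cast_pos.2 hM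
  calc 1 - ENNReal.ofReal (8 / ((p : ℝ) ^ 3 * M))
      = 1 - ENNReal.ofReal (4 * (M + M : ℕ) / ((p : ℝ) ^ 3 * M ^ 2)) := by
        congr 2
        push_cast
        field_simp
        norm_num
    _ ≤ G(V, p) {G | (p : ℝ) ^ 3 * M ^ 2 / 2 ≤ (Finset.univ.filter fun q => G ∈ E q).card} :=
        one_sub_le_measure_half_le_card_filter (fun _ => measurableSet_pendantGraph_adj) hdep
          (by positivity) hsum
    _ ≤ _ := measure_mono fun G hG => by
        rw [Set.mem_ofPred_eq] at hG ⊢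
        exact hG.trans (Nat.cast_le.2 (card_filter_adj_inl_inr_le (pendantGraph G f)))

end RandomPendantGraph

section PriceOfAnarchy

open ClusteringGame MeasureTheory SimpleGraph unitInterval

variable {V : Type*} [Fintype V] {c M : ℕ} {p : I}

lemma one_sub_le_binomialRandom_poaClass (hM : 0 < M) (hV : 4 * M ≤ Fintype.card V)
    (hc : 2 * M ≤ c) (hp : 0 < (p : ℝ)) :
    1 - ENNReal.ofReal (8 / ((p : ℝ) ^ 3 * M)) ≤ G(V, p) {G |
      ENNReal.ofReal ((p : ℝ) ^ 3 * M / 4) ≤ poaClass (symmetricCoordinationGames G c)} := by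
  classical
  obtain ⟨f⟩ : Nonempty ((Fin M ⊕ Fin M) × Bool ↪ V) :=
    Function.Embedding.nonempty_of_card_le (by simp; lia)
  have hcard : Fintype.card (Fin M ⊕ Fin M) = 2 * M := by simp [two_mul]
  have : (0 : ℝ) < M := Nat.cast_pos.2 hM
  refine (one_sub_le_binomialRandom_card_edgeFinset_pendantGraph hM f hp).trans
    (measure_mono fun G hG => ?_)
  rw [Set.mem_ofPred_eq] at hG ⊢
  calc ENNReal.ofReal ((p : ℝ) ^ 3 * M / 4)
      = ENNReal.ofReal ((p : ℝ) ^ 3 * M ^ 2 / 2 / (2 * M : ℕ)) := by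
        congr 1
        push_cast
        field_simp
        norm_num
    _ ≤ ENNReal.ofReal ((pendantGraph G f).edgeFinset.card / (2 * M : ℕ)) := by gcongr
    _ = (pendantGraph G f).edgeFinset.card / (2 * M : ℕ) := by
        rw [ENNReal.ofReal_div_of_pos (by positivity), ENNReal.ofReal_natCast,
          ENNReal.ofReal_natCast]
    _ ≤ poaClass (symmetricCoordinationGames G c) :=
        hcard ▸ card_edgeFinset_pendantGraph_div_card_le_poaClass f (hcard.trans_le hc)

lemma one_sub_le_binomialRandom_min_le_poaClass (h : 4 ≤ min c (Fintype.card V))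
    (hp : 0 < (p : ℝ)) :
    1 - ENNReal.ofReal (64 / ((p : ℝ) ^ 3 * min (c : ℝ) (Fintype.card V))) ≤ G(V, p) {G |
      ENNReal.ofReal ((p : ℝ) ^ 3 / 32 * min (c : ℝ) (Fintype.card V))
        ≤ poaClass (symmetricCoordinationGames G c)} := by
  set m := min c (Fintype.card V) with hm
  rw [← Nat.cast_min, ← hm]
  have hmM : (m : ℝ) ≤ 8 * (m / 4 : ℕ) := by exact_mod_cast (by lia : m ≤ 8 * (m / 4))
  have : (0 : ℝ) < m := Nat.cast_pos.2 (by lia)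
  calc 1 - ENNReal.ofReal (64 / ((p : ℝ) ^ 3 * m))
      ≤ 1 - ENNReal.ofReal (8 / ((p : ℝ) ^ 3 * (m / 4 : ℕ))) := by
        gcongr 1 - ENNReal.ofReal ?_
        calc 8 / ((p : ℝ) ^ 3 * (m / 4 : ℕ)) = 64 / ((p : ℝ) ^ 3 * (8 * (m / 4 : ℕ))) := by
              field_simp
              norm_num
          _ ≤ 64 / ((p : ℝ) ^ 3 * m) := by gcongr
    _ ≤ _ := one_sub_le_binomialRandom_poaClass (V := V) (M := m / 4) (by lia) (by lia) (by lia) hp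
    _ ≤ _ := measure_mono fun G hG => le_trans (ENNReal.ofReal_le_ofReal ?_) hG
  calc (p : ℝ) ^ 3 / 32 * m ≤ (p : ℝ) ^ 3 / 32 * (8 * (m / 4 : ℕ)) := by gcongr
    _ = (p : ℝ) ^ 3 * (m / 4 : ℕ) / 4 := by ring

theorem theorem5_general (p : ℕ → I) (c : ℕ → ℕ)
    (h : Tendsto (fun n => (p n : ℝ) ^ 3 * min (c n : ℝ) n) atTop atTop) :
    Tendsto (fun n => G(Fin n, p n) {G | ENNReal.ofReal ((p n : ℝ) ^ 3 / 32 * min (c n : ℝ) n)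
      ≤ poaClass (symmetricCoordinationGames G (c n))}) atTop (𝓝 1) := by
  have hlim : Tendsto (fun n => 1 - ENNReal.ofReal (64 / ((p n : ℝ) ^ 3 * min (c n : ℝ) n)))
      atTop (𝓝 1) := by
    simpa using ENNReal.Tendsto.sub tendsto_const_nhds
      (ENNReal.tendsto_ofReal (h.const_div_atTop 64)) (.inl ENNReal.one_ne_top)
  refine tendsto_of_tendsto_of_tendsto_of_le_of_le' hlim tendsto_const_nhds ?_
    (.of_forall fun n => prob_le_one)
  filter_upwards [h.eventually_ge_atTop 4] with n hn
  have hmin : (0 : ℝ) ≤ min (c n : ℝ) n := by positivity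
  have hp : 0 < (p n : ℝ) := (p n).2.1.lt_of_ne' fun hp => by norm_num [hp] at hn
  have hcn : 4 ≤ min (c n) n := by
    have hle : (p n : ℝ) ^ 3 * min (c n : ℝ) n ≤ min (c n : ℝ) n :=
      mul_le_of_le_one_left hmin (pow_le_one₀ (p n).2.1 (p n).2.2)
    exact_mod_cast hn.trans hle
  simpa using one_sub_le_binomialRandom_min_le_poaClass (V := Fin n) (by simpa using hcn) hp

end PriceOfAnarchy

theorem theorem5 (d : ℝ) (hd : d ∈ Set.Ioc (0 : ℝ) 1) :
    ∃ β : ℝ, 0 < β ∧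
      ∀ c : ℕ → ℕ, Tendsto c atTop atTop →
        Tendsto
          (fun n : ℕ =>
            G(Fin n, (⟨d, hd.1.le, hd.2⟩ : unitInterval))
              {G : SimpleGraph (Fin n) |
                ENNReal.ofReal (β * min (c n : ℝ) (n : ℝ)) ≤
                  ClusteringGame.poaClass (symmetricCoordinationGames G (c n))})
          atTop (𝓝 1) :=
  ⟨d ^ 3 / 32, div_pos (pow_pos hd.1 3) (by norm_num), fun c hc =>
    theorem5_general (fun _ => ⟨d, hd.1.le, hd.2⟩) c <|
      (tendsto_inf_atTop _ (tendsto_natCast_atTop_atTop.comp hc)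
        tendsto_natCast_atTop_atTop).const_mul_atTop (pow_pos hd.1 3)⟩
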